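/- Let $K=\mathrm{SU}(2)$, $U=K\times K$, $m_t=\operatorname{diag}(e^{it/2},e^{-it/2})\in K$, $a_t=(m_t,m_{-t})\in U$ and $A_*=\{a_t: 0\le t<4\pi\}$. For $\ell\in\frac12\mathbb N=\{0,\frac12,1,\dots\}$ let $H^\ell=\mathbb C[x,y]_{2\ell}$ be the space of homogeneous polynomials of degree $2\ell$, on which $K$ acts by $T^\ell(k)p=p\circ k^{t}$ (with $k^t$ the transpose of $k$), with the inner product for which $$\psi^\ell_j=\binom{2\ell}{\ell-j}^{1/2}x^{\ell-j}y^{\ell+j},\qquad j=-\ell,-\ell+1,\dots,\ell,$$ is an orthonormal basis; matrix entries of elements of $\mathrm{End}(H^\ell)$ refer to this basis. For $\ell_1,\ell_2\in\frac12\mathbb N$ with $|\ell_1-\ell_2|\le\ell\le\ell_1+\ell_2$ and $\ell_1+\ell_2-\ell\in\mathbb Z$, let $T^{\ell_1,\ell_2}(k_1,k_2)=T^{\ell_1}(k_1)\otimes T^{\ell_2}(k_2)$ on $H^{\ell_1}\otimes H^{\ell_2}$, let $\beta^{\ell_1,\ell_2}_\ell:H^\ell\to H^{\ell_1}\otimes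 H^{\ell_2}$ be the isometric $K$-intertwiner $$\psi^\ell_j\mapsto\sum_{j_1,j_2}C^{\ell_1,\ell_2,\ell}_{j_1,j_2,j}\,\psi^{\ell_1}_{j_1}\otimes\psi^{\ell_2}_{j_2}$$ given by the standard Clebsch–Gordan coefficients, and let $$\Phi^\ell_{\ell_1,\ell_2}(x)=(\beta^{\ell_1,\ell_2}_\ell)^*\circ T^{\ell_1,\ell_2}(x)\circ\beta^{\ell_1,\ell_2}_\ell\in\mathrm{End}(H^\ell),\qquad x\in U,$$ be the associated spherical function. The full spherical function of type $\ell$ and degree $0$ is the function $\Phi^\ell_0:A_*\to\mathrm{End}(H^\ell)$ with matrix entries $$\bigl(\Phi^\ell_0(a)\bigr)_{p,q}=\bigl(\Phi^\ell_{(\ell+p)/2,(\ell-p)/2}(a)\bigr)_{q,q},\qquad p,q\in\{-\ell,\dots,\ell\}.$$ Put $$v^\ell(a)=\Phi^\ell_0(a)\,\Phi^\ell_0(a)^*,\qquad V^\ell(a)=v^\ell(a)\,|D_*(a)|,\qquad D_*(a_t)=\sin^2t .$$ Let $J\in\mathrm{End}(H^\ell)$ be the flip $\psi^\ell_j\mapsto\psi^\ell_{-j}$.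 **Proposition.** For every $\ell\in\frac12\mathbb N$ the commutant $$\{V^\ell(a):a\in A_*\}'=\{Y\in\mathrm{End}(H^\ell): V^\ell(a)Y=YV^\ell(a)\text{ for all }a\in A_*\}$$ is equal to the commutant $\{v^\ell(a):a\in A_*\}'$, and it is exactly the complex linear span of $I$ and $J$. -/

import Mathlib

open scoped TensorProduct InnerProductSpace

noncomputable section

namespace SU2Spherical

/-! ### The groups -/

/-- `K = SU(2)`. -/
abbrev K : Type := Matrix.specialUnitaryGroup (Fin 2) ℂ

/-- `U = K × K`. -/
abbrev U : Type := K × K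

/-- The element `k(α, β)` of `SU(2)`, for `|α|² + |β|² = 1`. -/
def kElt (α β : ℂ) (h : ‖α‖ ^ 2 + ‖β‖ ^ 2 = 1) : K :=
  ⟨!![α, β; -(starRingEnd ℂ) β, (starRingEnd ℂ) α], by
    have h' : α * (starRingEnd ℂ) α + β * (starRingEnd ℂ) β = 1 := by
      rw [Complex.mul_conj', Complex.mul_conj']
      exact_mod_cast h
    rw [Matrix.mem_specialUnitaryGroup_iff]
    constructor
    · rw [Matrix.mem_unitaryGroup_iff]
      ext i j
      fin_cases i <;> fin_cases j <;>
        simp [Matrix.mul_apply, Fin.sum_univ_two, Matrix.star_apply] <;>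
        first
          | ring1
          | linear_combination h'
    · rw [Matrix.det_fin_two_of]
      linear_combination h'⟩

/-- `m_t = k(e^{it/2}, 0)`. -/
def mElt (t : ℝ) : K :=
  kElt (Complex.exp (Complex.I * (t / 2))) 0 (by
    have : ‖Complex.exp (Complex.I * (t / 2))‖ = 1 := by
      have := Complex.norm_exp_I_mul_ofReal (t / 2)
      push_cast at this
      exact this
    simp [this])

/-- `a_t = (m_t, m_{-t})`. -/
def aElt (t : ℝ) : U := (mElt t, mElt (-t))

/-- `A_* = {a_t : 0 ≤ t < 4π}`. -/
def Astar : Set U := {x | ∃ t : ℝ, 0 ≤ t ∧ t < 4 * Real.pi ∧ x = aElt t}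

/-! ### The spaces `H^ℓ` and the representations `T^ℓ`

Throughout, a spin `ℓ ∈ ½ℕ` is encoded by the natural number `n = 2ℓ`, and a weight
`j ∈ {-ℓ, -ℓ+1, …, ℓ}` by the index `i = ℓ + j ∈ {0, …, n}`. -/

/-- `H^ℓ = ℂ[x, y]_{2ℓ}`, the homogeneous polynomials of degree `n = 2ℓ` in two variables. -/
abbrev H (n : ℕ) : Type := ↥(MvPolynomial.homogeneousSubmodule (Fin 2) ℂ n)

/-- The substitution `p ↦ p ∘ kᵗ`, which replaces the `i`-th variable by the `i`-th coordinate
of `kᵗ (x, y)`. -/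
def subst (k : Matrix (Fin 2) (Fin 2) ℂ) :
    MvPolynomial (Fin 2) ℂ →ₐ[ℂ] MvPolynomial (Fin 2) ℂ :=
  MvPolynomial.aeval fun i => ∑ j, k.transpose i j • (MvPolynomial.X j : MvPolynomial (Fin 2) ℂ)

theorem subst_mem (k : Matrix (Fin 2) (Fin 2) ℂ) (n : ℕ) (p : MvPolynomial (Fin 2) ℂ)
    (hp : p ∈ MvPolynomial.homogeneousSubmodule (Fin 2) ℂ n) :
    subst k p ∈ MvPolynomial.homogeneousSubmodule (Fin 2) ℂ n := by
  have h := MvPolynomial.IsHomogeneous.aeval (n := 1) hp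
    (fun i => ∑ j, k.transpose i j • (MvPolynomial.X j : MvPolynomial (Fin 2) ℂ)) (fun i =>
      Submodule.sum_mem (MvPolynomial.homogeneousSubmodule (Fin 2) ℂ 1) fun j _ =>
        Submodule.smul_mem _ _ (MvPolynomial.isHomogeneous_X ℂ j))
  rw [one_mul] at h
  exact h

theorem subst_one : subst 1 = AlgHom.id ℂ (MvPolynomial (Fin 2) ℂ) := by
  ext1 i
  fin_cases i <;> simp [subst]

theorem subst_mul (k l : Matrix (Fin 2) (Fin 2) ℂ) :
    subst (k * l) = (subst k).comp (subst l) := by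
  ext1 i
  simp only [subst, AlgHom.comp_apply, MvPolynomial.aeval_X, Fin.sum_univ_two, map_add, map_smul,
    Matrix.transpose_apply, Matrix.mul_apply, smul_add, smul_smul, add_smul]
  simp only [mul_comm]
  abel

/-- The representation `T^ℓ` of `K` on `H^ℓ`, `T^ℓ(k) p = p ∘ kᵗ`. -/
def T (n : ℕ) : Representation ℂ K (H n) where
  toFun k := (subst k.1).toLinearMap.restrict (subst_mem k.1 n)
  map_one' := by
    ext1 p
    apply Subtype.ext
    simp [subst_one, LinearMap.restrict_apply]
  map_mul' k l := by
    ext1 p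
    apply Subtype.ext
    change subst (k * l : K).1 p.1 = subst k.1 (subst l.1 p.1)
    rw [show (k * l : K).1 = k.1 * l.1 from rfl, subst_mul]
    rfl

/-- The outer tensor product representation `T^{ℓ₁,ℓ₂}` of `U` on `H^{ℓ₁} ⊗ H^{ℓ₂}`. -/
def T₂ (n₁ n₂ : ℕ) : Representation ℂ U (H n₁ ⊗[ℂ] H n₂) where
  toFun x := TensorProduct.map (T n₁ x.1) (T n₂ x.2)
  map_one' := by simp [Module.End.one_eq_id]
  map_mul' x y := by simp [TensorProduct.map_mul]

/-! ### The standard weight basis and the Hermitian inner product -/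

/-- The standard weight vector `ψ^ℓ_j = binom(2ℓ, ℓ-j)^{1/2} x^{ℓ-j} y^{ℓ+j}`, with `i = ℓ + j`. -/
def psi (n : ℕ) (i : Fin (n + 1)) : H n :=
  ⟨MvPolynomial.C ((Real.sqrt (n.choose (n - i)) : ℝ) : ℂ) *
      (MvPolynomial.X 0 ^ (n - i : ℕ) * MvPolynomial.X 1 ^ (i : ℕ)), by
    have h := ((MvPolynomial.isHomogeneous_X ℂ (0 : Fin 2)).pow (n - i : ℕ)).mul
      ((MvPolynomial.isHomogeneous_X ℂ (1 : Fin 2)).pow (i : ℕ))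
    rw [one_mul, one_mul, Nat.sub_add_cancel (Nat.lt_succ_iff.mp i.2)] at h
    exact h.C_mul _⟩

/-- The exponent of the monomial `x^{n-i} y^i`. -/
def expo (n i : ℕ) : Fin 2 →₀ ℕ := Finsupp.single 0 (n - i) + Finsupp.single 1 i

theorem psi_coe (n : ℕ) (i : Fin (n + 1)) :
    (psi n i : MvPolynomial (Fin 2) ℂ) =
      MvPolynomial.monomial (expo n i) ((Real.sqrt (n.choose (n - i)) : ℝ) : ℂ) := by
  simp [psi, expo, MvPolynomial.X_pow_eq_monomial, MvPolynomial.monomial_mul,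
    MvPolynomial.C_mul_monomial]

theorem psi_coeff_ne_zero (n : ℕ) (i : Fin (n + 1)) :
    ((Real.sqrt (n.choose (n - i)) : ℝ) : ℂ) ≠ 0 := by
  have h : 0 < n.choose (n - i) := Nat.choose_pos (Nat.sub_le _ _)
  have h' : (0 : ℝ) < n.choose (n - i) := by exact_mod_cast h
  exact_mod_cast (Real.sqrt_pos.mpr h').ne'

theorem psi_linearIndependent (n : ℕ) : LinearIndependent ℂ (psi n) := by
  rw [Fintype.linearIndependent_iff]
  intro g hg i
  have h := congrArg (fun p : H n => MvPolynomial.coeff (expo n i) p.1) hg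
  simp only [Submodule.coe_sum, Submodule.coe_smul, MvPolynomial.coeff_sum,
    MvPolynomial.coeff_smul, psi_coe, MvPolynomial.coeff_monomial] at h
  rw [Finset.sum_eq_single i] at h
  · rw [if_pos rfl, smul_eq_mul] at h
    exact (mul_eq_zero.mp h).resolve_right (psi_coeff_ne_zero n i)
  · intro j _ hj
    rw [if_neg, smul_zero]
    intro hji
    apply hj
    apply Fin.ext
    simpa [expo] using DFunLike.congr_fun hji 1
  · simp

theorem psi_span (n : ℕ) : ⊤ ≤ Submodule.span ℂ (Set.range (psi n)) := by
  rintro ⟨p, hp⟩ -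
  have key : ∀ m ∈ p.support, ∃ q ∈ Submodule.span ℂ (Set.range (psi n)),
      (q : MvPolynomial (Fin 2) ℂ) = MvPolynomial.monomial m (p.coeff m) := by
    intro m hm
    have hd : m.degree = n := by
      rw [Finsupp.degree_eq_weight_one]
      exact hp (MvPolynomial.mem_support_iff.mp hm)
    have hd' : m 0 + m 1 = n := by
      rw [← hd, Finsupp.degree_eq_sum, Fin.sum_univ_two]
    let i : Fin (n + 1) := ⟨m 1, by omega⟩
    refine ⟨(p.coeff m / ((Real.sqrt (n.choose (n - i)) : ℝ) : ℂ)) • psi n i,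
      Submodule.smul_mem _ _ (Submodule.subset_span ⟨i, rfl⟩), ?_⟩
    have hm : expo n i = m := by
      ext j
      fin_cases j
      · simp [expo, i]; omega
      · simp [expo, i]
    rw [Submodule.coe_smul, psi_coe, MvPolynomial.smul_monomial, smul_eq_mul,
      div_mul_cancel₀ _ (psi_coeff_ne_zero n i), hm]
  choose! q hq hq' using key
  have : (⟨p, hp⟩ : H n) = ∑ m ∈ p.support, q m := by
    apply Subtype.ext
    rw [Submodule.coe_sum, Finset.sum_congr rfl hq', MvPolynomial.support_sum_monomial_coeff]
  rw [this]
  exact Submodule.sum_mem _ hq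

/-- The standard weight basis `ψ^ℓ_{-ℓ}, …, ψ^ℓ_ℓ` of `H^ℓ`. -/
def psiBasis (n : ℕ) : Module.Basis (Fin (n + 1)) ℂ (H n) :=
  Module.Basis.mk (psi_linearIndependent n) (psi_span n)

@[simp]
theorem psiBasis_apply (n : ℕ) (i : Fin (n + 1)) : psiBasis n i = psi n i := by
  simp [psiBasis]

/-- The Hermitian inner product on `H^ℓ` for which the standard weight basis is orthonormal
(conjugate-linear in the first variable, as is the convention in Mathlib). -/
@[reducible]
def innerCore (n : ℕ) : InnerProductSpace.Core ℂ (H n) where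
  inner p q := ∑ i, (starRingEnd ℂ) ((psiBasis n).repr p i) * (psiBasis n).repr q i
  conj_inner_symm p q := by simp [mul_comm]
  re_inner_nonneg p := by
    rw [map_sum]
    refine Finset.sum_nonneg fun i _ => ?_
    rw [← Complex.normSq_eq_conj_mul_self]
    simpa using Complex.normSq_nonneg _
  add_left p q r := by simp [add_mul, Finset.sum_add_distrib]
  smul_left p q c := by simp [Finset.mul_sum, mul_assoc]
  definite p h := by
    have h' : ∑ i, Complex.normSq ((psiBasis n).repr p i) = 0 := by
      have : ((∑ i, Complex.normSq ((psiBasis n).repr p i) : ℝ) : ℂ) = 0 := by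
        rw [← h]
        push_cast
        exact Finset.sum_congr rfl fun i _ => Complex.normSq_eq_conj_mul_self
      exact_mod_cast this
    rw [Finset.sum_eq_zero_iff_of_nonneg fun i _ => Complex.normSq_nonneg _] at h'
    apply (psiBasis n).repr.injective
    ext i
    simpa using h' i (Finset.mem_univ i)

instance (n : ℕ) : NormedAddCommGroup (H n) := (innerCore n).toNormedAddCommGroup

instance (n : ℕ) : InnerProductSpace ℂ (H n) := InnerProductSpace.ofCore (innerCore n).toCore

instance (n : ℕ) : FiniteDimensional ℂ (H n) := (psiBasis n).finiteDimensional_of_finite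

theorem psiBasis_orthonormal (n : ℕ) : Orthonormal ℂ (psiBasis n) := by
  rw [orthonormal_iff_ite]
  intro i j
  change ∑ k, (starRingEnd ℂ) ((psiBasis n).repr (psiBasis n i) k) *
    (psiBasis n).repr (psiBasis n j) k = _
  simp [Module.Basis.repr_self, Finsupp.single_apply, -psiBasis_apply]

/-! ### Clebsch–Gordan coefficients and spherical functions -/

/-- The condition `|ℓ₁ - ℓ₂| ≤ ℓ ≤ ℓ₁ + ℓ₂`, `ℓ₁ + ℓ₂ - ℓ ∈ ℤ`, for `(n₁, n₂, n) = (2ℓ₁, 2ℓ₂, 2ℓ)`. -/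
def Contains (n₁ n₂ n : ℕ) : Prop :=
  n ≤ n₁ + n₂ ∧ n₁ ≤ n₂ + n ∧ n₂ ≤ n₁ + n ∧ Even (n₁ + n₂ + n)

open Classical in
/-- The Clebsch–Gordan coefficient `C^{ℓ₁,ℓ₂,ℓ}_{j₁,j₂,j}` in its standard normalization, by
Racah's formula, with `(n₁, n₂, n) = (2ℓ₁, 2ℓ₂, 2ℓ)` and `(i₁, i₂, i) = (ℓ₁ + j₁, ℓ₂ + j₂, ℓ + j)`.
It vanishes unless `j₁ + j₂ = j`. With `a = ℓ₁ + ℓ₂ - ℓ` one has `ℓ₁ - j₁ = n₁ - i₁`, `ℓ₂ + j₂ = i₂`,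
`ℓ - ℓ₂ + j₁ = i₁ - a`, `ℓ - ℓ₁ - j₂ = (n₂ - i₂) - a`, and the sum runs over all `k` for which
the arguments of the factorials are nonnegative. -/
def clebschGordan (n₁ n₂ n i₁ i₂ i : ℕ) : ℝ :=
  let a := (n₁ + n₂ - n) / 2
  let b := (n₁ + n - n₂) / 2
  let c := (n₂ + n - n₁) / 2
  if Contains n₁ n₂ n ∧ i₁ + i₂ = i + a then
    Real.sqrt ((n + 1) * a.factorial * b.factorial * c.factorial /
        ((n₁ + n₂ + n) / 2 + 1).factorial) *
      Real.sqrt (i.factorial * (n - i).factorial * i₁.factorial * (n₁ - i₁).factorial *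
        i₂.factorial * (n₂ - i₂).factorial) *
      ∑ k ∈ (Finset.range (a + 1)).filter
          (fun k => k ≤ n₁ - i₁ ∧ k ≤ i₂ ∧ a ≤ i₁ + k ∧ a ≤ n₂ - i₂ + k),
        (-1 : ℝ) ^ k / (k.factorial * (a - k).factorial * (n₁ - i₁ - k).factorial *
          (i₂ - k).factorial * (i₁ + k - a).factorial * (n₂ - i₂ + k - a).factorial)
  else 0

/-- The intertwiner `β^{ℓ₁,ℓ₂}_ℓ : H^ℓ → H^{ℓ₁} ⊗ H^{ℓ₂}`, sending `ψ^ℓ_j` to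
`φ^{ℓ₁,ℓ₂}_{ℓ,j} = ∑ C^{ℓ₁,ℓ₂,ℓ}_{j₁,j₂,j} ψ^{ℓ₁}_{j₁} ⊗ ψ^{ℓ₂}_{j₂}`. -/
def beta (n₁ n₂ n : ℕ) : H n →ₗ[ℂ] H n₁ ⊗[ℂ] H n₂ :=
  (psiBasis n).constr ℂ fun i =>
    ∑ i₁ : Fin (n₁ + 1), ∑ i₂ : Fin (n₂ + 1),
      (clebschGordan n₁ n₂ n i₁ i₂ i : ℂ) • (psi n₁ i₁ ⊗ₜ[ℂ] psi n₂ i₂)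

/-- The spherical function `Φ^ℓ_{ℓ₁,ℓ₂}(x) = β* ∘ T^{ℓ₁,ℓ₂}(x) ∘ β` of type `ℓ`. -/
def Phi (n₁ n₂ n : ℕ) (x : U) : Module.End ℂ (H n) :=
  LinearMap.adjoint (beta n₁ n₂ n) ∘ₗ T₂ n₁ n₂ x ∘ₗ beta n₁ n₂ n

/-! ### Full spherical functions and the weight -/

/-- `ζ(d, k) = ((d + ℓ + k)/2, (d + ℓ - k)/2)`: the pair `(2ℓ₁, 2ℓ₂)` with `n = 2ℓ`, `p = ℓ + k`. -/
def zeta (n d : ℕ) (p : Fin (n + 1)) : ℕ × ℕ := (d + p, d + (n - p))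

/-- The full spherical function `Φ^ℓ_d : A_* → End(H^ℓ)`: its matrix in the standard weight basis is
`(Φ^ℓ_d(a))_{p,q} = (Φ^ℓ_{ζ(d,p)}(a))_{q,q}`. -/
def fullPhi (n d : ℕ) (a : Astar) : Module.End ℂ (H n) :=
  Matrix.toLin (psiBasis n) (psiBasis n) <| Matrix.of fun p q =>
    LinearMap.toMatrix (psiBasis n) (psiBasis n)
      (Phi (zeta n d p).1 (zeta n d p).2 n a.1) q q

/-- `v^ℓ(a) = Φ^ℓ_0(a) Φ^ℓ_0(a)*`. -/
def v (n : ℕ) (a : Astar) : Module.End ℂ (H n) :=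
  fullPhi n 0 a * LinearMap.adjoint (fullPhi n 0 a)

/-- `D_*(a_t) = sin² t`. The upper left entry of `m_t` is `e^{it/2}`, so that `sin t` is the
imaginary part of its square. -/
def Dstar (a : Astar) : ℝ := ((a.1.1.1 0 0) ^ 2).im ^ 2

theorem Dstar_aElt (t : ℝ) (h : aElt t ∈ Astar) : Dstar ⟨aElt t, h⟩ = Real.sin t ^ 2 := by
  have : (Complex.exp (Complex.I * (t / 2))) ^ 2 = Complex.exp (t * Complex.I) := by
    rw [← Complex.exp_nat_mul]
    congr 1
    push_cast
    ring
  simp [Dstar, aElt, mElt, kElt, this, Complex.exp_ofReal_mul_I_im]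

/-- The weight `V^ℓ(a) = Φ^ℓ_0(a) Φ^ℓ_0(a)* |D_*(a)|`. -/
def V (n : ℕ) (a : Astar) : Module.End ℂ (H n) := ((|Dstar a| : ℝ) : ℂ) • v n a

/-- The flip `J : ψ^ℓ_j ↦ ψ^ℓ_{-j}`. -/
def J (n : ℕ) : Module.End ℂ (H n) := (psiBasis n).constr ℂ fun i => psi n i.rev

end SU2Spherical

end

namespace SU2Spherical

open Polynomial

/-! ### The polynomials giving the entries of the full spherical function of degree zero -/

/-! In degree zero `ℓ₁ + ℓ₂ = ℓ`, so only the top component of the tensor product occurs. There the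
squared Clebsch–Gordan coefficients are quotients of binomials, and `a_t` acts diagonally on product
weight vectors. With `w = e^{it}`, the entry `(p, q)` of the full spherical function is therefore
`e^{-int/2}` times `sphPoly p (n - p) q` at `w`, divided by `binom(n, q)`. Here `sphPoly m k r` is
the coefficient of `z ^ r` in `(X + z) ^ m * (1 + X z) ^ k`.

Since `conj w = w⁻¹`, the weight becomes `v(a_t) = e^{-int} W(w)` with the matrix polynomial `W =
weightPoly n`. Where `sin t ≠ 0` the scalars `D_*` and `e^{-int}` cancel, and this leaves infinitely
many `w`; so an element `Y` of the commutant of `V` commutes with every coefficient of `W`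
(`coeff_weightPoly_comm`). Two coefficients suffice. The constant one, `W₀`, is antidiagonal with
entries `binom(n, p)⁻²`; the linear one, `W₁`, vanishes for `p + q > n + 1` and is nonzero for `p +
q = n + 1`.

Commuting with `W₀` and `W₁` propagates column 0 of `Y` to all other columns
(`eq_zero_of_mem_centralizer`). Commuting with `W₀` also kills column 0 except in its first and last
rows (`toMatrix_zero_of_mem_centralizer`), and these are matched by a combination of `I` and `J`.
Conversely `W` is invariant under reversing both indices, so `J` commutes with `v`. The inclusions
span ⊆ commutant of `v` ⊆ commutant of `V` ⊆ span close up. -/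

/-- The polynomial `∑ binom(m, i) binom(k, j) X^{m - i + j}` over all `i + j = r`. -/
noncomputable def sphPoly (m k r : ℕ) : ℂ[X] :=
  ∑ i : Fin (m + 1), ∑ j : Fin (k + 1),
    if (i : ℕ) + j = r then C ((m.choose i : ℂ) * k.choose j) * X ^ (m - i + j : ℕ) else 0

theorem sphPoly_eval (m k r : ℕ) (w : ℂ) :
    (sphPoly m k r).eval w = ∑ i : Fin (m + 1), ∑ j : Fin (k + 1),
      if (i : ℕ) + j = r then (m.choose i : ℂ) * k.choose j * w ^ (m - i + j : ℕ) else 0 := by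
  simp only [sphPoly, eval_finsetSum]
  refine Finset.sum_congr rfl fun i _ => Finset.sum_congr rfl fun j _ => ?_
  split_ifs <;> simp

theorem sphPoly_coeff (m k r d : ℕ) :
    (sphPoly m k r).coeff d = ∑ i : Fin (m + 1), ∑ j : Fin (k + 1),
      if (i : ℕ) + j = r ∧ d = m - i + j then (m.choose i : ℂ) * k.choose j else 0 := by
  simp only [sphPoly, finsetSum_coeff]
  refine Finset.sum_congr rfl fun i _ => Finset.sum_congr rfl fun j _ => ?_
  rw [ite_and]
  split_ifs <;> simp_all [coeff_C_mul, coeff_X_pow, -map_mul]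

theorem sphPoly_coeff_zero (m k r : ℕ) :
    (sphPoly m k r).coeff 0 = if r = m then 1 else 0 := by
  rw [sphPoly_coeff, Fintype.sum_eq_single (Fin.last m), Fintype.sum_eq_single 0]
  · simp [eq_comm]
  · intro j hj
    rw [if_neg]
    have : (j : ℕ) ≠ 0 := fun h => hj (Fin.ext h)
    omega
  · intro i hi
    have : (i : ℕ) ≠ m := fun h => hi (Fin.ext h)
    refine Finset.sum_eq_zero fun j _ => if_neg ?_
    omega

theorem sphPoly_coeff_one_of_eq {m k r : ℕ} (h : r + 1 = m) : (sphPoly m k r).coeff 1 = m := by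
  subst h
  rw [sphPoly_coeff, Fintype.sum_eq_single ⟨r, by omega⟩, Fintype.sum_eq_single 0]
  · simp
  · intro j hj
    rw [if_neg]
    have : (j : ℕ) ≠ 0 := fun h => hj (Fin.ext h)
    simp
    omega
  · intro i hi
    have : (i : ℕ) ≠ r := fun h => hi (Fin.ext h)
    refine Finset.sum_eq_zero fun j _ => if_neg ?_
    omega

theorem sphPoly_coeff_one_of_lt {m k r : ℕ} (h : r + 1 < m) : (sphPoly m k r).coeff 1 = 0 := by
  rw [sphPoly_coeff]
  refine Finset.sum_eq_zero fun i _ => Finset.sum_eq_zero fun j _ => if_neg ?_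
  omega

/-- The substitution `z ↦ 1/z` in the generating function `(X + z) ^ m * (1 + X z) ^ k`, cleared by
`z ^ (m + k)`, exchanges `m` and `k`. This is the source of the symmetry under `J`. -/
theorem sphPoly_comm {m k r s : ℕ} (h : r + s = m + k) : sphPoly k m r = sphPoly m k s := by
  rw [sphPoly, sphPoly, Finset.sum_comm, ← Equiv.sum_comp Fin.revPerm]
  refine Finset.sum_congr rfl fun i _ => ?_
  rw [← Equiv.sum_comp Fin.revPerm]
  refine Finset.sum_congr rfl fun j _ => ?_
  have hi := i.2
  have hj := j.2
  simp only [Fin.revPerm_apply, Fin.val_rev]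
  have h1 : m.choose (m + 1 - (i + 1)) = m.choose i := by
    rw [Nat.add_sub_add_right, Nat.choose_symm (by omega)]
  have h2 : k.choose (k + 1 - (j + 1)) = k.choose j := by
    rw [Nat.add_sub_add_right, Nat.choose_symm (by omega)]
  rw [h1, h2, mul_comm (k.choose j : ℂ)]
  refine if_congr (by omega) ?_ rfl
  congr 2
  omega

/-- On the unit circle conjugation inverts `w`, and reversing both summation indices sends the
exponent `e` to `m + k - e`. This makes the adjoint in `v` polynomial in `w`. -/
theorem sphPoly_eval_conj {m k r s : ℕ} (h : r + s = m + k) {w : ℂ} (hw : ‖w‖ = 1) :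
    w ^ (m + k) * (starRingEnd ℂ) ((sphPoly m k r).eval w) = (sphPoly m k s).eval w := by
  have hw' : w * (starRingEnd ℂ) w = 1 := by simp [Complex.mul_conj', hw]
  rw [sphPoly_eval, sphPoly_eval, map_sum, Finset.mul_sum, ← Equiv.sum_comp Fin.revPerm]
  refine Finset.sum_congr rfl fun i _ => ?_
  rw [map_sum, Finset.mul_sum, ← Equiv.sum_comp Fin.revPerm]
  refine Finset.sum_congr rfl fun j _ => ?_
  have hi := i.2
  have hj := j.2
  simp only [Fin.revPerm_apply, Fin.val_rev]
  have h1 : m.choose (m + 1 - (i + 1)) = m.choose i := by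
    rw [Nat.add_sub_add_right, Nat.choose_symm (by omega)]
  have h2 : k.choose (k + 1 - (j + 1)) = k.choose j := by
    rw [Nat.add_sub_add_right, Nat.choose_symm (by omega)]
  rw [h1, h2]
  by_cases hc : (i : ℕ) + j = s
  · rw [if_pos (by omega), if_pos hc]
    simp only [map_mul, map_pow, map_natCast]
    have : w ^ (m + k) = w ^ (m - i + j : ℕ) * w ^ (m - (m + 1 - (i + 1)) + (k + 1 - (j + 1))) := by
      rw [← pow_add]
      congr 1
      omega
    rw [this]
    have h3 : w ^ (m - (m + 1 - (i + 1)) + (k + 1 - (j + 1)) : ℕ) *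
        (starRingEnd ℂ) w ^ (m - (m + 1 - (i + 1)) + (k + 1 - (j + 1)) : ℕ) = 1 := by
      rw [← mul_pow, hw', one_pow]
    linear_combination (m.choose i : ℂ) * k.choose j * w ^ (m - i + j : ℕ) * h3
  · rw [if_neg (by omega), if_neg hc]
    simp

/-- The polynomial `P` for which the `(p, q)` entry of `v(a_t)` is `e^{-int} P(e^{it})`. -/
noncomputable def weightPoly (n : ℕ) (p q : Fin (n + 1)) : ℂ[X] :=
  ∑ r : Fin (n + 1), C (((n.choose r : ℂ) ^ 2)⁻¹) *
    (sphPoly p (n - p) r * sphPoly q (n - q) (n - r))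

theorem weightPoly_rev (n : ℕ) (p q : Fin (n + 1)) :
    weightPoly n p.rev q.rev = weightPoly n p q := by
  rw [weightPoly, weightPoly, ← Equiv.sum_comp Fin.revPerm]
  refine Finset.sum_congr rfl fun r _ => ?_
  have hr := r.2
  have hp := p.2
  have hq := q.2
  have e (x : Fin (n + 1)) : ((x.rev : Fin (n + 1)) : ℕ) = n - x := by rw [Fin.val_rev]; omega
  have e' (x : Fin (n + 1)) : n - (n - (x : ℕ)) = x := by omega
  simp only [Fin.revPerm_apply, e, e', Nat.choose_symm (Nat.lt_succ_iff.mp hr)]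
  rw [sphPoly_comm (m := p) (s := r) (by omega), sphPoly_comm (m := q) (s := n - r) (by omega)]

theorem weightPoly_coeff_zero (n : ℕ) (p q : Fin (n + 1)) :
    (weightPoly n p q).coeff 0 = if q = p.rev then ((n.choose p : ℂ) ^ 2)⁻¹ else 0 := by
  rw [weightPoly, finsetSum_coeff, Fintype.sum_eq_single p]
  · rw [coeff_C_mul, mul_coeff_zero, sphPoly_coeff_zero, sphPoly_coeff_zero]
    have : n - (p : ℕ) = q ↔ q = p.rev := by
      rw [Fin.ext_iff, Fin.val_rev]
      omega
    simp [this]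
  · intro r hr
    rw [coeff_C_mul, mul_coeff_zero, sphPoly_coeff_zero,
      if_neg fun h => hr (Fin.ext h)]
    simp

/-- In a product, one factor must contribute its constant term, forcing `r = p` or `n - r = q`. The
other factor has a linear term only if its index is at least `q - 1`, respectively `p - 1`; either
way `p + q ≤ n + 1`. -/
theorem weightPoly_coeff_one_of_lt {n : ℕ} {p q : Fin (n + 1)} (h : n + 1 < (p : ℕ) + q) :
    (weightPoly n p q).coeff 1 = 0 := by
  rw [weightPoly, finsetSum_coeff]
  refine Finset.sum_eq_zero fun r _ => ?_
  rw [coeff_C_mul, mul_coeff_one, sphPoly_coeff_zero, sphPoly_coeff_zero]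
  split_ifs with h1 h2 h2
  · omega
  · rw [sphPoly_coeff_one_of_lt (m := q) (by omega)]; simp
  · rw [sphPoly_coeff_one_of_lt (m := p) (by omega)]; simp
  · simp

theorem weightPoly_coeff_one_of_eq {n : ℕ} {p q : Fin (n + 1)} (h : (p : ℕ) + q = n + 1) :
    (weightPoly n p q).coeff 1 ≠ 0 := by
  have hp := p.2
  have hq := q.2
  have hne : p ≠ q.rev := by
    rw [Ne, Fin.ext_iff, Fin.val_rev]
    omega
  have hv : ((q.rev : Fin (n + 1)) : ℕ) = n - q := by rw [Fin.val_rev]; omega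
  -- Only `r = p` and `r = n - q = p - 1` contribute, and both contributions are positive, so they
  -- cannot cancel.
  have key : (weightPoly n p q).coeff 1 =
      ((n.choose p : ℂ) ^ 2)⁻¹ * q + ((n.choose (n - q) : ℂ) ^ 2)⁻¹ * p := by
    rw [weightPoly, finsetSum_coeff, Fintype.sum_eq_add p q.rev hne]
    · rw [coeff_C_mul, coeff_C_mul, mul_coeff_one, mul_coeff_one, hv]
      simp only [sphPoly_coeff_zero]
      rw [sphPoly_coeff_one_of_eq (m := q) (r := n - p) (by omega),
        sphPoly_coeff_one_of_eq (m := p) (r := n - q) (by omega), if_true,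
        if_neg (show ¬ n - (p : ℕ) = q by omega), if_neg (show ¬ n - (q : ℕ) = p by omega),
        if_pos (show n - (n - (q : ℕ)) = q by omega)]
      simp
    · rintro r ⟨h1, h2⟩
      have h1' : (r : ℕ) ≠ p := fun h => h1 (Fin.ext h)
      have h2' : n - (r : ℕ) ≠ q := fun h => h2 (Fin.ext (by omega))
      rw [coeff_C_mul, mul_coeff_one, sphPoly_coeff_zero, sphPoly_coeff_zero, if_neg h1',
        if_neg h2']
      simp
  have h1 : 0 < n.choose p := Nat.choose_pos (by omega)
  have h2 : 0 < n.choose (n - q) := Nat.choose_pos (by omega)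
  have h3 : (0 : ℝ) < ((n.choose p : ℝ) ^ 2)⁻¹ * q + ((n.choose (n - q) : ℝ) ^ 2)⁻¹ * p := by
    have hq0 : 0 < (q : ℕ) := by omega
    have hp0 : 0 < (p : ℕ) := by omega
    positivity
  rw [key]
  intro h0
  refine h3.ne' (Complex.ofReal_injective ?_)
  push_cast
  exact h0

/-! ### The spherical functions for `ℓ = ℓ₁ + ℓ₂` -/

theorem T_mElt_psi (n : ℕ) (t : ℝ) (i : Fin (n + 1)) :
    T n (mElt t) (psi n i) =
      (Complex.exp (Complex.I * (t / 2)) ^ (n - i : ℕ) *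
        Complex.exp (-(Complex.I * (t / 2))) ^ (i : ℕ)) • psi n i := by
  have hc : (starRingEnd ℂ) (Complex.exp (Complex.I * (t / 2))) =
      Complex.exp (-(Complex.I * (t / 2))) := by
    rw [← Complex.exp_conj, map_mul, Complex.conj_I, neg_mul]
    congr 3
    exact_mod_cast Complex.conj_ofReal (t / 2)
  apply Subtype.ext
  change subst (mElt t).1 (psi n i).1 = _
  have h0 : subst (mElt t).1 (MvPolynomial.X 0) =
      Complex.exp (Complex.I * (t / 2)) • MvPolynomial.X 0 := by
    simp [subst, mElt, kElt]
  have h1 : subst (mElt t).1 (MvPolynomial.X 1) =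
      Complex.exp (-(Complex.I * (t / 2))) • MvPolynomial.X 1 := by
    rw [← hc]
    simp [subst, mElt, kElt]
  have hC (c : ℂ) : subst (mElt t).1 (MvPolynomial.C c) = MvPolynomial.C c := by
    simp [subst, MvPolynomial.algebraMap_eq]
  simp only [psi, map_mul, map_pow, h0, h1, hC, _root_.smul_pow, smul_mul_assoc, mul_smul_comm,
    Submodule.coe_smul, smul_smul]
  rw [mul_comm]

/-- `C^2 = binom(2ℓ₁, ℓ₁ + j₁) binom(2ℓ₂, ℓ₂ + j₂) / binom(2ℓ, ℓ + j)` for `ℓ = ℓ₁ + ℓ₂`. -/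
theorem clebschGordan_add_sq {n₁ n₂ i₁ i₂ i : ℕ} (h₁ : i₁ ≤ n₁) (h₂ : i₂ ≤ n₂) :
    clebschGordan n₁ n₂ (n₁ + n₂) i₁ i₂ i ^ 2 =
      if i₁ + i₂ = i then (n₁.choose i₁ * n₂.choose i₂ / (n₁ + n₂).choose i : ℝ) else 0 := by
  have hc : Contains n₁ n₂ (n₁ + n₂) := by
    refine ⟨le_rfl, by omega, by omega, ?_⟩
    exact ⟨n₁ + n₂, rfl⟩
  have ha : (n₁ + n₂ - (n₁ + n₂)) / 2 = 0 := by omega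
  have hb : (n₁ + (n₁ + n₂) - n₂) / 2 = n₁ := by omega
  have hd : (n₂ + (n₁ + n₂) - n₁) / 2 = n₂ := by omega
  have he : (n₁ + n₂ + (n₁ + n₂)) / 2 = n₁ + n₂ := by omega
  simp only [clebschGordan, ha, hb, hd, he, hc, true_and, add_zero]
  split_ifs with h
  · subst h
    -- Here `a = 0`, so Racah's sum reduces to its term `k = 0`.
    have hs : (Finset.range (0 + 1)).filter
        (fun k => k ≤ n₁ - i₁ ∧ k ≤ i₂ ∧ 0 ≤ i₁ + k ∧ 0 ≤ n₂ - i₂ + k) = {0} := by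
      ext k
      simp
      omega
    rw [hs, Finset.sum_singleton, mul_pow, mul_pow, Real.sq_sqrt (by positivity),
      Real.sq_sqrt (by positivity), Nat.cast_choose ℝ h₁, Nat.cast_choose ℝ h₂,
      Nat.cast_choose ℝ (by omega : i₁ + i₂ ≤ n₁ + n₂)]
    simp only [Nat.factorial_succ, Nat.factorial_zero, pow_zero, Nat.sub_zero, add_zero]
    push_cast
    have f (x : ℕ) : (x.factorial : ℝ) ≠ 0 := by exact_mod_cast x.factorial_ne_zero
    have g : (n₁ + n₂ + 1 : ℝ) ≠ 0 := by positivity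
    have := f i₁
    have := f i₂
    have := f (n₁ - i₁)
    have := f (n₂ - i₂)
    have := f (i₁ + i₂)
    have := f (n₁ + n₂ - (i₁ + i₂))
    have := f (n₁ + n₂)
    field_simp
  · simp

theorem toMatrix_psiBasis_apply (n : ℕ) (f : Module.End ℂ (H n)) (p q : Fin (n + 1)) :
    LinearMap.toMatrix (psiBasis n) (psiBasis n) f p q = ⟪psi n p, f (psi n q)⟫_ℂ := by
  rw [LinearMap.toMatrix_apply, psiBasis_apply]
  have := ((psiBasis n).toOrthonormalBasis (psiBasis_orthonormal n)).repr_apply_apply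
    (f (psi n q)) p
  rw [Module.Basis.coe_toOrthonormalBasis, psiBasis_apply] at this
  rw [← this]
  simp [Module.Basis.toOrthonormalBasis]

theorem inner_psi (n : ℕ) (i j : Fin (n + 1)) :
    ⟪psi n i, psi n j⟫_ℂ = if i = j then 1 else 0 := by
  have := orthonormal_iff_ite.mp (psiBasis_orthonormal n) i j
  simpa using this

/-- The action of `a_t` on the product weight vectors is diagonal. -/
theorem T₂_aElt_psi (n₁ n₂ : ℕ) (t : ℝ) (i₁ : Fin (n₁ + 1)) (i₂ : Fin (n₂ + 1)) :
    T₂ n₁ n₂ (aElt t) (psi n₁ i₁ ⊗ₜ[ℂ] psi n₂ i₂) =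
      (Complex.exp (-(Complex.I * (t / 2))) ^ (n₁ + n₂) *
        Complex.exp (Complex.I * t) ^ (n₁ - i₁ + i₂ : ℕ)) • (psi n₁ i₁ ⊗ₜ[ℂ] psi n₂ i₂) := by
  change TensorProduct.map (T n₁ (mElt t)) (T n₂ (mElt (-t))) _ = _
  rw [TensorProduct.map_tmul, T_mElt_psi, T_mElt_psi, TensorProduct.smul_tmul_smul]
  congr 1
  simp only [← Complex.exp_nat_mul, ← Complex.exp_add]
  congr 1
  have h₁ : (i₁ : ℕ) ≤ n₁ := Nat.lt_succ_iff.mp i₁.2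
  have h₂ : (i₂ : ℕ) ≤ n₂ := Nat.lt_succ_iff.mp i₂.2
  push_cast [Nat.cast_sub h₁, Nat.cast_sub h₂]
  ring

theorem inner_smul_psi_tmul (n₁ n₂ : ℕ) (a b : ℂ) (i₁ j₁ : Fin (n₁ + 1)) (i₂ j₂ : Fin (n₂ + 1)) :
    ⟪a • (psi n₁ i₁ ⊗ₜ[ℂ] psi n₂ i₂), b • (psi n₁ j₁ ⊗ₜ[ℂ] psi n₂ j₂)⟫_ℂ =
      (starRingEnd ℂ) a * b * ((if i₁ = j₁ then 1 else 0) * (if i₂ = j₂ then 1 else 0)) := by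
  refine (inner_smul_left (psi n₁ i₁ ⊗ₜ[ℂ] psi n₂ i₂) (b • (psi n₁ j₁ ⊗ₜ[ℂ] psi n₂ j₂)) a).trans ?_
  rw [mul_assoc]
  congr 1
  refine (inner_smul_right (psi n₁ i₁ ⊗ₜ[ℂ] psi n₂ i₂) (psi n₁ j₁ ⊗ₜ[ℂ] psi n₂ j₂) b).trans ?_
  rw [TensorProduct.inner_tmul, inner_psi, inner_psi]

/-- Product weight vectors are orthonormal, so an operator diagonal on them has as its matrix
coefficient the eigenvalues averaged with weights `C ^ 2`. -/
theorem toMatrix_Phi_diag (n₁ n₂ n : ℕ) (x : U) (q : Fin (n + 1))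
    (c : Fin (n₁ + 1) → Fin (n₂ + 1) → ℂ)
    (hc : ∀ i₁ i₂, T₂ n₁ n₂ x (psi n₁ i₁ ⊗ₜ[ℂ] psi n₂ i₂) =
      c i₁ i₂ • (psi n₁ i₁ ⊗ₜ[ℂ] psi n₂ i₂)) :
    LinearMap.toMatrix (psiBasis n) (psiBasis n) (Phi n₁ n₂ n x) q q =
      ∑ i₁ : Fin (n₁ + 1), ∑ i₂ : Fin (n₂ + 1),
        ((clebschGordan n₁ n₂ n i₁ i₂ q ^ 2 : ℝ) : ℂ) * c i₁ i₂ := by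
  have hb : beta n₁ n₂ n (psi n q) = ∑ i₁ : Fin (n₁ + 1), ∑ i₂ : Fin (n₂ + 1),
      (clebschGordan n₁ n₂ n i₁ i₂ q : ℂ) • (psi n₁ i₁ ⊗ₜ[ℂ] psi n₂ i₂) := by
    rw [← psiBasis_apply, beta, Module.Basis.constr_basis]
  rw [toMatrix_psiBasis_apply]
  change ⟪psi n q, LinearMap.adjoint (beta n₁ n₂ n) (T₂ n₁ n₂ x (beta n₁ n₂ n (psi n q)))⟫_ℂ = _
  rw [LinearMap.adjoint_inner_right, hb]
  simp only [map_sum, map_smul, hc, sum_inner, inner_sum, smul_smul, inner_smul_psi_tmul,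
    Complex.conj_ofReal]
  refine Finset.sum_congr rfl fun i₁ _ => Finset.sum_congr rfl fun i₂ _ => ?_
  rw [Fintype.sum_eq_single i₁ fun j hj => by simp [hj],
    Fintype.sum_eq_single i₂ fun j hj => by simp [hj]]
  simp
  ring

/-! ### The entries of the weight -/

theorem toMatrix_Phi_add {n₁ n₂ n : ℕ} (h : n₁ + n₂ = n) (t : ℝ) (q : Fin (n + 1)) :
    LinearMap.toMatrix (psiBasis n) (psiBasis n) (Phi n₁ n₂ n (aElt t)) q q =
      Complex.exp (-(Complex.I * (t / 2))) ^ n *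
        ((sphPoly n₁ n₂ q).eval (Complex.exp (Complex.I * t)) / n.choose q) := by
  subst h
  rw [toMatrix_Phi_diag _ _ _ _ _ _ (T₂_aElt_psi n₁ n₂ t), sphPoly_eval, Finset.sum_div,
    Finset.mul_sum]
  refine Finset.sum_congr rfl fun i₁ _ => ?_
  rw [Finset.sum_div, Finset.mul_sum]
  refine Finset.sum_congr rfl fun i₂ _ => ?_
  rw [clebschGordan_add_sq (Nat.lt_succ_iff.mp i₁.2) (Nat.lt_succ_iff.mp i₂.2)]
  split_ifs
  · push_cast
    ring
  · simp

theorem toMatrix_fullPhi (n : ℕ) (t : ℝ) (h : aElt t ∈ Astar) (p q : Fin (n + 1)) :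
    LinearMap.toMatrix (psiBasis n) (psiBasis n) (fullPhi n 0 ⟨aElt t, h⟩) p q =
      Complex.exp (-(Complex.I * (t / 2))) ^ n *
        ((sphPoly p (n - p) q).eval (Complex.exp (Complex.I * t)) / n.choose q) := by
  rw [fullPhi, LinearMap.toMatrix_toLin, Matrix.of_apply]
  have hp : (zeta n 0 p).1 + (zeta n 0 p).2 = n := by
    simp only [zeta]
    omega
  rw [toMatrix_Phi_add hp]
  simp [zeta]

theorem toMatrix_v (n : ℕ) (t : ℝ) (h : aElt t ∈ Astar) (p q : Fin (n + 1)) :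
    LinearMap.toMatrix (psiBasis n) (psiBasis n) (v n ⟨aElt t, h⟩) p q =
      Complex.exp (-(Complex.I * t)) ^ n *
        (weightPoly n p q).eval (Complex.exp (Complex.I * t)) := by
  have hadj := LinearMap.toMatrix_adjoint
    ((psiBasis n).toOrthonormalBasis (psiBasis_orthonormal n))
    ((psiBasis n).toOrthonormalBasis (psiBasis_orthonormal n)) (fullPhi n 0 ⟨aElt t, h⟩)
  rw [Module.Basis.toBasis_toOrthonormalBasis] at hadj
  rw [v, LinearMap.toMatrix_mul, hadj, Matrix.mul_apply, weightPoly, eval_finsetSum,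
    Finset.mul_sum]
  refine Finset.sum_congr rfl fun r _ => ?_
  have hr := r.2
  have hq := q.2
  have hw : ‖Complex.exp (Complex.I * t)‖ = 1 := Complex.norm_exp_I_mul_ofReal t
  have hG := sphPoly_eval_conj (m := q) (k := n - q) (r := r) (s := n - r) (by omega) hw
  rw [Nat.add_sub_cancel' (by omega)] at hG
  have h1 : Complex.exp (-(Complex.I * t)) ^ n * Complex.exp (Complex.I * t) ^ n = 1 := by
    rw [← mul_pow, ← Complex.exp_add, neg_add_cancel, Complex.exp_zero, one_pow]
  have hn : ‖Complex.exp (-(Complex.I * (t / 2)))‖ = 1 := by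
    have := Complex.norm_exp_I_mul_ofReal (-(t / 2))
    push_cast at this
    rwa [mul_neg] at this
  have h2 : Complex.exp (-(Complex.I * (t / 2))) ^ n *
      (starRingEnd ℂ) (Complex.exp (-(Complex.I * (t / 2)))) ^ n = 1 := by
    rw [← mul_pow, Complex.mul_conj', hn]
    simp
  rw [Matrix.conjTranspose_apply, toMatrix_fullPhi, toMatrix_fullPhi, eval_mul, eval_mul, eval_C,
    ← hG, ← starRingEnd_apply, map_mul, map_div₀, map_pow, map_natCast]
  set e := Complex.exp (-(Complex.I * (t / 2))) ^ n
  set e' := (starRingEnd ℂ) (Complex.exp (-(Complex.I * (t / 2)))) ^ n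
  set u := Complex.exp (-(Complex.I * t)) ^ n
  set w := Complex.exp (Complex.I * t) ^ n
  generalize (sphPoly p (n - p) r).eval (Complex.exp (Complex.I * t)) = g
  generalize (starRingEnd ℂ) ((sphPoly q (n - q) r).eval (Complex.exp (Complex.I * t))) = g'
  generalize (n.choose r : ℂ) = b
  -- The half-angle phases cancel by `h2`; `h1` absorbs the factor `w ^ n` introduced by `hG`.
  linear_combination (g * g' * (b ^ 2)⁻¹) * (h2 - h1)

/-! ### The commutant -/

theorem toMatrix_J (n : ℕ) (p q : Fin (n + 1)) :
    LinearMap.toMatrix (psiBasis n) (psiBasis n) (J n) p q = if p = q.rev then 1 else 0 := by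
  rw [LinearMap.toMatrix_apply, J, Module.Basis.constr_basis, ← psiBasis_apply,
    Module.Basis.repr_self, Finsupp.single_apply]
  simp [eq_comm]

theorem J_mem_centralizer (n : ℕ) : J n ∈ Subalgebra.centralizer ℂ (Set.range (v n)) := by
  rw [Subalgebra.mem_centralizer_iff]
  rintro _ ⟨⟨_, ha⟩, rfl⟩
  obtain ⟨t, -, -, rfl⟩ := id ha
  apply (LinearMap.toMatrix (psiBasis n) (psiBasis n)).injective
  ext p q
  rw [LinearMap.toMatrix_mul, LinearMap.toMatrix_mul, Matrix.mul_apply, Matrix.mul_apply]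
  simp only [toMatrix_J, toMatrix_v]
  rw [Fintype.sum_eq_single q.rev fun r hr => by simp [hr],
    Fintype.sum_eq_single p.rev fun r hr => by
      rw [if_neg (fun h => hr (by rw [h, Fin.rev_rev])), zero_mul]]
  rw [← weightPoly_rev n p q.rev]
  simp

theorem centralizer_v_le_centralizer_V (n : ℕ) :
    Subalgebra.centralizer ℂ (Set.range (v n)) ≤ Subalgebra.centralizer ℂ (Set.range (V n)) := by
  intro Y hY
  rw [Subalgebra.mem_centralizer_iff] at hY ⊢
  rintro _ ⟨a, rfl⟩
  rw [V, smul_mul_assoc, mul_smul_comm, hY _ ⟨a, rfl⟩]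

theorem infinite_exp_image : ((fun t : ℝ => Complex.exp (Complex.I * t)) ''
    Set.Ioo 0 Real.pi).Infinite := by
  refine (Set.Ioo_infinite Real.pi_pos).image fun s hs t ht h => ?_
  -- The real part of `e^{it}` is `cos t`, which is injective on `[0, π]`.
  refine Real.injOn_cos (Set.Ioo_subset_Icc_self hs) (Set.Ioo_subset_Icc_self ht) ?_
  have := congrArg Complex.re h
  simpa [mul_comm Complex.I, Complex.exp_ofReal_mul_I_re] using this

/-- An operator in the commutant of the weight commutes with all coefficients of the matrix
polynomial `weightPoly`. -/
theorem coeff_weightPoly_comm {n : ℕ} {Y : Module.End ℂ (H n)}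
    (hY : Y ∈ Subalgebra.centralizer ℂ (Set.range (V n))) (d : ℕ) (p q : Fin (n + 1)) :
    ∑ r, (weightPoly n p r).coeff d * LinearMap.toMatrix (psiBasis n) (psiBasis n) Y r q =
      ∑ r, LinearMap.toMatrix (psiBasis n) (psiBasis n) Y p r * (weightPoly n r q).coeff d := by
  set M := LinearMap.toMatrix (psiBasis n) (psiBasis n) Y with hM
  have key : ∑ r, weightPoly n p r * C (M r q) - ∑ r, C (M p r) * weightPoly n r q = 0 := by
    -- On `0 < t < π` the factor `sin² t` is nonzero and can be cancelled.
    refine eq_zero_of_infinite_isRoot _ (infinite_exp_image.mono ?_)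
    rintro _ ⟨t, ⟨ht0, htπ⟩, rfl⟩
    have ha : aElt t ∈ Astar := ⟨t, ht0.le, by linarith [Real.pi_pos], rfl⟩
    have h := (Subalgebra.mem_centralizer_iff ℂ).mp hY _ ⟨⟨aElt t, ha⟩, rfl⟩
    have hD : ((|Dstar ⟨aElt t, ha⟩| : ℝ) : ℂ) ≠ 0 := by
      rw [Dstar_aElt, Complex.ofReal_ne_zero]
      have := Real.sin_pos_of_pos_of_lt_pi ht0 htπ
      positivity
    rw [V, smul_mul_assoc, mul_smul_comm] at h
    have h' := congrArg (fun f => LinearMap.toMatrix (psiBasis n) (psiBasis n) f p q)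
      (smul_right_injective _ hD h)
    simp only [LinearMap.toMatrix_mul, Matrix.mul_apply, toMatrix_v, ← hM] at h'
    have hE : Complex.exp (-(Complex.I * t)) ^ n ≠ 0 := pow_ne_zero _ (Complex.exp_ne_zero _)
    simp only [mul_assoc, mul_left_comm (M _ _), ← Finset.mul_sum] at h'
    have h'' := mul_left_cancel₀ hE h'
    simp only [Set.mem_ofPred_eq, IsRoot, eval_sub, eval_finsetSum, eval_mul, eval_C]
    rw [h'', sub_self]
  have := congrArg (coeff · d) (sub_eq_zero.mp key)
  simpa [finsetSum_coeff, coeff_C_mul, coeff_mul_C] using this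

/-- An operator in the commutant is determined by its value on the lowest weight vector. -/
theorem eq_zero_of_mem_centralizer {n : ℕ} {Y : Module.End ℂ (H n)}
    (hY : Y ∈ Subalgebra.centralizer ℂ (Set.range (V n)))
    (h0 : ∀ p, LinearMap.toMatrix (psiBasis n) (psiBasis n) Y p 0 = 0) : Y = 0 := by
  have hc := coeff_weightPoly_comm hY
  set M := LinearMap.toMatrix (psiBasis n) (psiBasis n) Y with hM
  have hb (p : Fin (n + 1)) : ((n.choose p : ℂ) ^ 2)⁻¹ ≠ 0 := by
    have : n.choose p ≠ 0 := (Nat.choose_pos (Nat.lt_succ_iff.mp p.2)).ne'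
    have : (n.choose p : ℂ) ≠ 0 := by exact_mod_cast this
    exact inv_ne_zero (pow_ne_zero _ this)
  -- `W₀` maps `e_q` to a nonzero multiple of `e_{n-q}`, so `Y e_q = 0` forces `Y e_{n-q} = 0`.
  have hrev (q : Fin (n + 1)) (hq : ∀ p, M p q = 0) (p : Fin (n + 1)) : M p q.rev = 0 := by
    have h := hc 0 p q
    simp only [hq, mul_zero, Finset.sum_const_zero] at h
    rw [Fintype.sum_eq_single q.rev] at h
    · rw [weightPoly_coeff_zero, Fin.rev_rev, if_pos rfl] at h
      exact (mul_eq_zero.mp h.symm).resolve_right (hb _)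
    · intro r hr
      rw [weightPoly_coeff_zero, if_neg fun h => hr (by rw [h, Fin.rev_rev]), mul_zero]
  have main : ∀ k (hk : k < n + 1) (p : Fin (n + 1)), M p ⟨k, hk⟩ = 0 := by
    intro k
    induction k using Nat.strong_induction_on with
    | _ k ih =>
      intro hk p
      obtain _ | k := k
      · exact h0 p
      -- Column `n - k` of `W₁` is supported in rows `r ≤ k + 1`, with a nonzero entry at `k + 1`.
      -- Since `Y` kills `e_0, …, e_k` and `e_{n-k}`, it kills `e_{k+1}`.
      have h := hc 1 p (Fin.rev ⟨k, by omega⟩)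
      simp only [hrev _ (ih k (by omega) (by omega)), mul_zero, Finset.sum_const_zero] at h
      rw [Fintype.sum_eq_single ⟨k + 1, hk⟩] at h
      · refine (mul_eq_zero.mp h.symm).resolve_right (weightPoly_coeff_one_of_eq ?_)
        rw [Fin.val_rev]
        simp only
        omega
      · intro r hr
        have hr' : (r : ℕ) ≠ k + 1 := fun h => hr (Fin.ext h)
        rcases Nat.lt_or_ge r (k + 1) with hlt | hge
        · rw [ih r hlt r.2, zero_mul]
        · rw [weightPoly_coeff_one_of_lt, mul_zero]
          rw [Fin.val_rev]
          simp only
          omega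
  apply (LinearMap.toMatrix (psiBasis n) (psiBasis n)).injective
  rw [map_zero]
  ext p q
  exact main q q.2 p

/-- `Y` commutes with `W₀²`, which is diagonal with entries `binom(n, p)⁻⁴`. The entry at index 0 is
1, shared only with index `n`. The proof applies the relation for `W₀` twice. -/
theorem toMatrix_zero_of_mem_centralizer {n : ℕ} {Y : Module.End ℂ (H n)}
    (hY : Y ∈ Subalgebra.centralizer ℂ (Set.range (V n))) {p : Fin (n + 1)} (hp : p ≠ 0)
    (hp' : p ≠ Fin.last n) : LinearMap.toMatrix (psiBasis n) (psiBasis n) Y p 0 = 0 := by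
  have hc := coeff_weightPoly_comm hY 0
  set M := LinearMap.toMatrix (psiBasis n) (psiBasis n) Y with hM
  have h (p q : Fin (n + 1)) : ((n.choose p : ℂ) ^ 2)⁻¹ * M p.rev q =
      M p q.rev * ((n.choose q : ℂ) ^ 2)⁻¹ := by
    have h := hc p q
    rw [Fintype.sum_eq_single p.rev fun r hr => by
        rw [weightPoly_coeff_zero, if_neg hr, zero_mul],
      Fintype.sum_eq_single q.rev fun r hr => by
        rw [weightPoly_coeff_zero, if_neg fun h => hr (by rw [h, Fin.rev_rev]), mul_zero],
      weightPoly_coeff_zero, weightPoly_coeff_zero, if_pos rfl, Fin.rev_rev, if_pos rfl] at h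
    rw [h, Fin.val_rev, Nat.add_sub_add_right, Nat.choose_symm (Nat.lt_succ_iff.mp q.2)]
  have h1 := h p (Fin.last n)
  have h2 := h p.rev 0
  have h3 : n.choose (p.rev : Fin (n + 1)) = n.choose p := by
    rw [Fin.val_rev, Nat.add_sub_add_right, Nat.choose_symm (Nat.lt_succ_iff.mp p.2)]
  rw [h3] at h2
  simp only [Fin.rev_last, Fin.rev_zero, Fin.rev_rev, Fin.val_last, Fin.val_zero,
    Nat.choose_self, Nat.choose_zero_right, Nat.cast_one, one_pow, inv_one, mul_one] at h1 h2
  have hp0 : (p : ℕ) ≠ 0 := fun h => hp (Fin.ext h)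
  have hpn : (p : ℕ) ≠ n := fun h => hp' (Fin.ext h)
  have hlt := p.2
  have hb : 1 < n.choose p := by
    obtain ⟨m, rfl⟩ : ∃ m, n = m + 1 := ⟨n - 1, by omega⟩
    obtain ⟨k, hk⟩ : ∃ k, (p : ℕ) = k + 1 := ⟨p - 1, by omega⟩
    rw [hk, Nat.choose_succ_succ']
    have := Nat.choose_pos (n := m) (k := k) (by omega)
    have := Nat.choose_pos (n := m) (k := k + 1) (by omega)
    omega
  have hb' : (n.choose p : ℂ) ^ 4 ≠ 1 := by
    have : n.choose p ^ 4 ≠ 1 := (Nat.one_lt_pow (by norm_num) hb).ne'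
    exact_mod_cast this
  have hne : (n.choose p : ℂ) ≠ 0 := by
    have : n.choose p ≠ 0 := by omega
    exact_mod_cast this
  generalize (n.choose p : ℂ) = b at *
  have h4 : (b ^ 4 - 1) * M p 0 = 0 := by
    have e2 : M p 0 = b ^ 2 * M p.rev (Fin.last n) := by
      rw [← h2]; field_simp
    have e1 : M p.rev (Fin.last n) = b ^ 2 * M p 0 := by
      rw [← h1]; field_simp
    linear_combination -e2 - b ^ 2 * e1
  exact (mul_eq_zero.mp h4).resolve_left (sub_ne_zero.mpr hb')

theorem mem_span_of_mem_centralizer {n : ℕ} {Y : Module.End ℂ (H n)}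
    (hY : Y ∈ Subalgebra.centralizer ℂ (Set.range (V n))) :
    Y ∈ Submodule.span ℂ {(1 : Module.End ℂ (H n)), J n} := by
  let M := LinearMap.toMatrix (psiBasis n) (psiBasis n) Y
  -- For `n = 0` the first and last rows coincide and `J = I`, so the coefficient of `J` must be
  -- dropped to avoid counting the entry twice.
  let d : ℂ := if n = 0 then 0 else M (Fin.last n) 0
  have hJ := centralizer_v_le_centralizer_V n (J_mem_centralizer n)
  have hZ : Y - (M 0 0 • 1 + d • J n) ∈ Subalgebra.centralizer ℂ (Set.range (V n)) :=
    sub_mem hY (add_mem (Subalgebra.smul_mem _ (one_mem _) _) (Subalgebra.smul_mem _ hJ _))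
  have h0 : Y - (M 0 0 • 1 + d • J n) = 0 := by
    refine eq_zero_of_mem_centralizer hZ fun p => ?_
    by_cases hp : p = 0
    · subst hp
      by_cases hn : n = 0
      · simp [M, d, hn, LinearMap.toMatrix_one]
      · have : (0 : Fin (n + 1)) ≠ Fin.last n := by
          rw [Ne, Fin.ext_iff]
          simpa using Ne.symm hn
        simp [M, LinearMap.toMatrix_one, toMatrix_J, this]
    · have hn : n ≠ 0 := by
        rintro rfl
        exact hp (Fin.ext (by omega))
      by_cases hp' : p = Fin.last n
      · subst hp'
        simp [M, d, hn, LinearMap.toMatrix_one, toMatrix_J, hp]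
      · exact toMatrix_zero_of_mem_centralizer hZ hp hp'
  rw [sub_eq_zero.mp h0, Submodule.mem_span_pair]
  exact ⟨_, _, rfl⟩

end SU2Spherical

theorem mainTheorem4 (n : ℕ) :
    Subalgebra.centralizer ℂ (Set.range (SU2Spherical.V n)) =
        Subalgebra.centralizer ℂ (Set.range (SU2Spherical.v n)) ∧
      Subalgebra.toSubmodule (Subalgebra.centralizer ℂ (Set.range (SU2Spherical.V n))) =
        Submodule.span ℂ {(1 : Module.End ℂ (SU2Spherical.H n)), SU2Spherical.J n} := by
  have h : Submodule.span ℂ {(1 : Module.End ℂ (SU2Spherical.H n)), SU2Spherical.J n} ≤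
      Subalgebra.toSubmodule (Subalgebra.centralizer ℂ (Set.range (SU2Spherical.v n))) := by
    rw [Submodule.span_le]
    rintro _ (rfl | rfl)
    · exact one_mem (Subalgebra.centralizer ℂ (Set.range (SU2Spherical.v n)))
    · exact SU2Spherical.J_mem_centralizer n
  have hle := SU2Spherical.centralizer_v_le_centralizer_V n
  exact ⟨le_antisymm (fun _ hY => h (SU2Spherical.mem_span_of_mem_centralizer hY)) hle,
    le_antisymm (fun _ hY => SU2Spherical.mem_span_of_mem_centralizer hY)
      (h.trans fun _ hY => hle hY)⟩
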